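/- **Setting.** Let $n\ge 0$, $N=2^n$, and label the computational basis of an $n$-qubit index register by bit strings $b\in\{0,1\}^n$. A *quadrature rule* on a grid of $N$ points is $Q_n[g]=\sum_b w_b\,g(x_b)$ with nodes $x_b\in[0,1]$, weights $w_b\ge 0$, $\sum_b w_b=1$ (for instance $x_b=i(b)/2^n$, $i(b)=\sum_k b_k2^k$, $w_b=2^{-n}$: the left Riemann sum on the uniform grid). Its error is $E_n[g]=\bigl|\int_0^1 g-Q_n[g]\bigr|$. For $h:\{0,1\}^n\to[0,1]$ the angle map is $\Theta_h(b)=2\arcsin\sqrt{h(b)}$; $h\in\mathcal G_n^{(d)}$ means that $\Theta_h$ is a multilinear polynomial in $b_0,\dots,b_{n-1}$ of degree at most $d$. Write $\hat\Theta_S=\sum_{T\subseteq S}(-1)^{|S\setminus T|}\Theta_h(\mathbf 1_T)$ for its multilinear coefficients and $\binom{n}{\le d}=\sum_{k=0}^d\binom nk$. The encoding operator $G_h$ acts on index register and one ancilla qubit as the rotation $R_Y(\Theta_h(b))$ of the ancilla when the index is $b$; $C^SR_Y(\theta)$ rotates the ancilla by $R_Y(\theta)$ when all index qubits in $S$ are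 $1$. The oracle is $A=G_h\,(V\otimes I)$, where $V$ is any unitary with $V u_{0\cdots0}=\sum_b\sqrt{w_b}\,u_b$ ($V=H^{\otimes n}$ for equal weights); its *amplitude* is the probability that the ancilla is measured as $1$ after applying $A$ to $u_{0\cdots 0}\otimes u_0$. The cost of an oracle call is the number of controlled-$R_Y$ gates in $G_h$ (the preparation $V$, which does not depend on $g$, is not counted, and neither is an additional control of the whole call). *MLAE.* For a finite set $\mathcal K\subset\mathbb N_0$ with $N_k$ shots for $k\in\mathcal K$, run $N_k$ independent times the circuit $Q^kA$, with $Q=AS_{e_0}A^*S_{w_0}$ the Grover iterate ($S_v$ the reflection in the hyperplane orthogonal to $v$; $e_0$ the initial state, $w_0$ the ancilla-$0$ component of $Ae_0$), and count $m_k$ outcomes $1$ of the ancilla. An MLAE estimator $\hat a$ is any maximiser over $a\in[0,1]$ of $\sum_k\bigl[m_k\log p_k(a)+(N_k-m_k)\log(1-p_k(a))\bigr]$, $p_k(a)=\sin^2((2k+1)\arcsin\sqrt a)$. The number of oracle calls is $M=\sum_kN_k(2k+1)$. *Query algorithm with $M$ calls.* A quantum algorithm on index register, ancilla and a finite work register that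 applies fixed unitaries, independent of the oracle, alternating with $M$ calls of $A$ or $A^*$ (each possibly controlled by the work register), measures in the computational basis and outputs a real number $\hat a$ depending on the outcome. **Theorem (Depth-accuracy trade-off).** There are a universal constant $C_0>0$ and, for all $n$ and $M$, a query algorithm $\mathcal A_{n,M}$ with exactly $M$ calls such that for $M\ge1$ and every unitary oracle $A$ with amplitude $a$ its output satisfies $\mathbb E[(\hat a-a)^2]^{1/2}\le C_0/M$, and such that the following holds. Let $g:[0,1]\to[0,1]$, $g\in C^\alpha[0,1]$ with $\alpha\ge p\ge1$ ($p$ an integer), $d\ge0$, $C_p>0$ and $\delta\in(0,1)$. 1. Let $Q_n$ be a quadrature rule with $E_n[g]\le C_p2^{-pn}\|g^{(p)}\|_\infty$ and such that $h:b\mapsto g(x_b)$ lies in $\mathcal G_n^{(d)}$. Then $G_h=\prod_{|S|\le d}C^SR_Y(\hat\Theta_S)$, a circuit of exactly $\binom n{\le d}$ gates, and the amplitude of the oracle $A$ is $Q_n[g]$. If moreover $\varepsilon>0$ and $$n\ge\frac1p\log_2\Bigl(\frac{2C_p\|g^{(p)}\|_\infty}{\varepsilon}\Bigr)$$ (no condition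 if $\|g^{(p)}\|_\infty=0$), then $\mathbb P\bigl(\bigl|\int_0^1g-\hat a\bigr|\le\varepsilon\bigr)\ge1-\delta$ in each of the following cases: (a) $\hat a$ is an MLAE estimator for a schedule with $M$ oracle calls, $C_{\mathrm{est}}>0$ is a constant in its error bound, $\mathbb E[(\hat a-Q_n[g])^2]^{1/2}\le C_{\mathrm{est}}/M$, and $M\ge\dfrac{2C_{\mathrm{est}}}{\varepsilon\sqrt\delta}$; (b) $\hat a$ is the output of $\mathcal A_{n,M}$ with the oracle $A$, and $M\ge\dfrac{2C_0}{\varepsilon\sqrt\delta}$. 2. For every constant $C_{\mathrm{est}}>0$ (in particular $C_{\mathrm{est}}=C_0$), with the minimal numbers $n^*(\varepsilon)=\max\bigl(0,\bigl\lceil\frac1p\log_2(2C_p\|g^{(p)}\|_\infty/\varepsilon)\bigr\rceil\bigr)$ (and $n^*(\varepsilon)=0$ if $\|g^{(p)}\|_\infty=0$) and $M^*(\varepsilon)=\lceil 2C_{\mathrm{est}}/(\varepsilon\sqrt\delta)\rceil$, the total number of gates in all oracle calls satisfies, as $\varepsilon\to0^+$, $$\binom{n^*(\varepsilon)}{\le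 d}\,M^*(\varepsilon)=O\Bigl(\Bigl(\frac{\log(1/\varepsilon)}{p}\Bigr)^d\cdot\frac1\varepsilon\Bigr).$$ -/

import Mathlib

open scoped BigOperators Matrix Kronecker Topology

noncomputable section

namespace QAE

/-! ### Bit strings, quadrature rules, the angle-structure hierarchy -/

/-- Bit strings `b = (b₀, …, b_{n-1})`; they label the `2 ^ n` grid points and the computational
basis of the `n`-qubit index register. -/
abbrev Bits (n : ℕ) : Type := Fin n → Bool

/-- The grid index `i(b) = ∑ₖ bₖ 2ᵏ`. -/
def gridIndex {n : ℕ} (b : Bits n) : ℕ := ∑ k : Fin n, if b k then 2 ^ (k : ℕ) else 0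

theorem gridIndex_le {n : ℕ} (b : Bits n) : gridIndex b ≤ 2 ^ n := by
  have h1 : gridIndex b ≤ ∑ k : Fin n, 2 ^ (k : ℕ) := by
    refine Finset.sum_le_sum fun k _ => ?_
    split <;> simp
  have h2 : ∑ k : Fin n, 2 ^ (k : ℕ) = ∑ k ∈ Finset.range n, 2 ^ k :=
    Fin.sum_univ_eq_sum_range (fun k => 2 ^ k) n
  have h3 : ∑ k ∈ Finset.range n, 2 ^ k < 2 ^ n := Nat.geomSum_lt (le_refl 2) (by simp)
  omega

/-- A quadrature rule on a grid of `2 ^ n` points of `[0, 1]`, exact on constants, with nonnegative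
weights (so that its values on functions `[0, 1] → [0, 1]` are probabilities). -/
structure QuadratureRule (n : ℕ) where
  /-- the grid points -/
  node : Bits n → ℝ
  node_mem : ∀ b, node b ∈ Set.Icc (0 : ℝ) 1
  /-- the weights -/
  weight : Bits n → ℝ
  weight_nonneg : ∀ b, 0 ≤ weight b
  weight_sum : ∑ b, weight b = 1

/-- The value `Q_n[g]` of a quadrature rule. -/
def QuadratureRule.approx {n : ℕ} (R : QuadratureRule n) (g : ℝ → ℝ) : ℝ :=
  ∑ b, R.weight b * g (R.node b)

/-- The values of `g` on the grid of the rule. -/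
def QuadratureRule.samples {n : ℕ} (R : QuadratureRule n) (g : ℝ → ℝ) : Bits n → ℝ :=
  fun b => g (R.node b)

/-- The left Riemann sum on the uniform grid `{i / 2 ^ n : 0 ≤ i < 2 ^ n}`. -/
def leftRiemann (n : ℕ) : QuadratureRule n where
  node b := (gridIndex b : ℝ) / 2 ^ n
  node_mem b := by
    refine ⟨by positivity, ?_⟩
    rw [div_le_one (by positivity)]
    exact_mod_cast gridIndex_le b
  weight _ := 1 / 2 ^ n
  weight_nonneg _ := by positivity
  weight_sum := by simp

/-- The discretisation error `E_n[g] = |∫₀¹ g - Q_n[g]|`. -/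
def QuadratureRule.error {n : ℕ} (R : QuadratureRule n) (g : ℝ → ℝ) : ℝ :=
  |(∫ x in (0 : ℝ)..1, g x) - R.approx g|

/-- The supremum norm on `[0, 1]` of the `p`-th derivative of `g`. -/
def supNormDeriv (p : ℕ) (g : ℝ → ℝ) : ℝ :=
  ⨆ x : Set.Icc (0 : ℝ) 1, |iteratedDerivWithin p g (Set.Icc 0 1) x|

/-- The angle map `Θ_h(b) = 2 arcsin √(h b)`. -/
def angleMap {n : ℕ} (h : Bits n → ℝ) (b : Bits n) : ℝ := 2 * Real.arcsin (Real.sqrt (h b))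

/-- The multilinear monomial `∏_{j ∈ S} b_j ∈ {0, 1}`. -/
def monomial {n : ℕ} (S : Finset (Fin n)) (b : Bits n) : ℝ := ∏ j ∈ S, if b j then 1 else 0

/-- `f` is given by a multilinear polynomial of degree at most `d`. -/
def MultilinearDegreeLE {n : ℕ} (f : Bits n → ℝ) (d : ℕ) : Prop :=
  ∃ c : Finset (Fin n) → ℝ, (∀ S, d < S.card → c S = 0) ∧ ∀ b, f b = ∑ S, c S * monomial S b

/-- The multilinear coefficients, given by Möbius inversion. -/
def multilinearCoeff {n : ℕ} (f : Bits n → ℝ) (S : Finset (Fin n)) : ℝ :=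
  ∑ T ∈ S.powerset, (-1) ^ (S \ T).card * f (fun j => decide (j ∈ T))

/-- The angle-structure class of degree `d`: `[0, 1]`-valued functions on the grid whose angle map
is multilinear of degree at most `d`. -/
def angleClass (n d : ℕ) : Set (Bits n → ℝ) :=
  {h | (∀ b, h b ∈ Set.Icc (0 : ℝ) 1) ∧ MultilinearDegreeLE (angleMap h) d}

/-! ### Circuits

The space of one ancilla qubit and `n` index qubits has the basis `Fin 2 × Bits n`. -/

/-- The basis labels of the ancilla and the index register. -/
abbrev Reg (n : ℕ) : Type := Fin 2 × Bits n

/-- The rotation `R_Y(θ)`. -/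
def rotY (θ : ℝ) : Matrix (Fin 2) (Fin 2) ℂ :=
  !![(Real.cos (θ / 2) : ℂ), -(Real.sin (θ / 2) : ℂ);
     (Real.sin (θ / 2) : ℂ), (Real.cos (θ / 2) : ℂ)]

/-- `C^S R_Y(θ)`: rotate the ancilla if all the index qubits in `S` are in state `1`. -/
def ctrlRotY {n : ℕ} (S : Finset (Fin n)) (θ : ℝ) : Matrix (Reg n) (Reg n) ℂ :=
  Matrix.blockDiagonal fun b : Bits n => if ∀ j ∈ S, b j = true then rotY θ else 1

/-- The matrix of a list of multi-controlled `R_Y` gates, each given by its controls and angle. -/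
def circuitMatrix {n : ℕ} (L : List (Finset (Fin n) × ℝ)) : Matrix (Reg n) (Reg n) ℂ :=
  (L.map fun q => ctrlRotY q.1 q.2).prod

/-- One gate `C^S R_Y` for every `S` with `|S| ≤ d`, its angle being the coefficient at `S` of the
angle map. -/
def monomialCircuit {n : ℕ} (d : ℕ) (h : Bits n → ℝ) : List (Finset (Fin n) × ℝ) :=
  ((Finset.univ.filter fun S : Finset (Fin n) => S.card ≤ d).toList).map
    fun S => (S, multilinearCoeff (angleMap h) S)

/-- The encoding operator: block diagonal, with block `R_Y(Θ_h(b))` at the index `b`. -/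
def encodingOp {n : ℕ} (h : Bits n → ℝ) : Matrix (Reg n) (Reg n) ℂ :=
  Matrix.blockDiagonal fun b : Bits n => rotY (angleMap h b)

/-- `V` prepares the weights of the rule in the index register: it is unitary and its first column
is `∑_b √w_b u_b`. For equal weights the Hadamard transform `H^{⊗ n}` is such a `V`. -/
def QuadratureRule.Prepares {n : ℕ} (R : QuadratureRule n)
    (V : Matrix (Bits n) (Bits n) ℂ) : Prop :=
  V ∈ Matrix.unitaryGroup (Bits n) ℂ ∧
    ∀ b, V b (fun _ => false) = (Real.sqrt (R.weight b) : ℂ)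

/-- The amplitude oracle: prepare the index register, then apply the encoding operator. -/
def amplitudeOracle {n : ℕ} (h : Bits n → ℝ) (V : Matrix (Bits n) (Bits n) ℂ) :
    Matrix (Reg n) (Reg n) ℂ :=
  encodingOp h * ((1 : Matrix (Fin 2) (Fin 2) ℂ) ⊗ₖ V)

/-- The initial state. -/
def initState (n : ℕ) : Reg n → ℂ := Pi.single (0, fun _ => false) 1

/-- The probability of measuring the ancilla in state `1`. -/
def ancillaProb {n : ℕ} (v : Reg n → ℂ) : ℝ := ∑ b : Bits n, ‖v (1, b)‖ ^ 2

/-- The amplitude encoded by `A`: the probability of ancilla outcome `1` after `A`. -/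
def amplitude {n : ℕ} (A : Matrix (Reg n) (Reg n) ℂ) : ℝ := ancillaProb (A *ᵥ initState n)

/-- The reflection through the hyperplane orthogonal to `v` (the identity if `v = 0`). -/
def reflection {n : ℕ} (v : Reg n → ℂ) : Matrix (Reg n) (Reg n) ℂ :=
  1 - (2 / (star v ⬝ᵥ v)) • Matrix.vecMulVec v (star v)

/-- The Grover iterate `A S_{e₀} A* S_{w₀}`, where `w₀` is the component of `A e₀` with ancilla
`0`. -/
def groverIterate {n : ℕ} (A : Matrix (Reg n) (Reg n) ℂ) : Matrix (Reg n) (Reg n) ℂ :=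
  A * reflection (initState n) * Aᴴ *
    reflection (fun x => if x.1 = 0 then (A *ᵥ initState n) x else 0)

/-- The probability of ancilla outcome `1` for the circuit `Q^k A`. -/
def levelProb {n : ℕ} (A : Matrix (Reg n) (Reg n) ℂ) (k : ℕ) : ℝ :=
  ancillaProb ((groverIterate A ^ k * A) *ᵥ initState n)

/-! ### Finite probability -/

/-- The probability of the event `E` for the weights `w`. -/
def finProb {Ω : Type} [Fintype Ω] (w : Ω → ℝ) (E : Set Ω) : ℝ := ∑ ω, E.indicator w ω

/-- The root mean square error of `est` as an estimator of `a`, for the weights `w`. -/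
def rmsError {Ω : Type} [Fintype Ω] (w : Ω → ℝ) (est : Ω → ℝ) (a : ℝ) : ℝ :=
  Real.sqrt (∑ ω, w ω * (est ω - a) ^ 2)

/-! ### Maximum likelihood amplitude estimation -/

/-- A finite set of levels `k`, and the number of shots of the circuit `Q^k A` at each level. -/
structure Schedule where
  /-- the levels -/
  levels : Finset ℕ
  /-- the number of shots at each level -/
  shots : ℕ → ℕ

/-- The number of oracle calls `∑ₖ N_k (2 k + 1)`. -/
def Schedule.cost (S : Schedule) : ℕ := ∑ k ∈ S.levels, S.shots k * (2 * k + 1)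

/-- The records of the ancilla outcomes of all shots (`true` for outcome `1`). -/
abbrev Schedule.Record (S : Schedule) : Type := (k : S.levels) → Fin (S.shots k) → Bool

/-- The probability of a record: the shots are independent, and a shot at level `k` has outcome `1`
with the probability given by the circuit `Q^k A`. -/
def Schedule.law {n : ℕ} (S : Schedule) (A : Matrix (Reg n) (Reg n) ℂ) (ω : S.Record) : ℝ :=
  ∏ k : S.levels, ∏ s : Fin (S.shots k),
    if ω k s then levelProb A k else 1 - levelProb A k

/-- The number `m_k` of outcomes `1` at level `k`. -/
def Schedule.hits (S : Schedule) (ω : S.Record) (k : S.levels) : ℕ :=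
  (Finset.univ.filter fun s : Fin (S.shots k) => ω k s = true).card

/-- The model probability `p_k(a) = sin²((2 k + 1) arcsin √a)`. -/
def modelProb (k : ℕ) (a : ℝ) : ℝ :=
  Real.sin ((2 * (k : ℝ) + 1) * Real.arcsin (Real.sqrt a)) ^ 2

/-- The likelihood of `a`, i.e. the exponential of the log-likelihood
`∑ₖ m_k log p_k(a) + (N_k - m_k) log (1 - p_k(a))`
(where `log 0 = -∞` and `0 · log 0 = 0`). -/
def Schedule.likelihood (S : Schedule) (ω : S.Record) (a : ℝ) : ℝ :=
  ∏ k : S.levels, modelProb k a ^ S.hits ω k * (1 - modelProb k a) ^ (S.shots k - S.hits ω k)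

/-- `est` is a maximum likelihood estimator: it selects a maximiser of the likelihood on
`[0, 1]`. -/
def Schedule.IsMLAE (S : Schedule) (est : S.Record → ℝ) : Prop :=
  ∀ ω, est ω ∈ Set.Icc (0 : ℝ) 1 ∧ IsMaxOn (S.likelihood ω) (Set.Icc 0 1) (est ω)

/-! ### Quantum query algorithms -/

/-- A quantum algorithm that uses an unknown unitary `A` on the ancilla and the index register as a
black box. Besides these it has a finite work register. It alternates fixed unitaries with calls of
`A` or `A*`, which may be controlled by the work register, then measures everything in the
computational basis and returns a real number depending on the outcome. -/
structure QueryAlgorithm (n : ℕ) where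
  /-- basis labels of the work register -/
  Work : Type
  [fintypeWork : Fintype Work]
  [decEqWork : DecidableEq Work]
  /-- initial state of the work register -/
  start : Work
  /-- the number of oracle calls -/
  calls : ℕ
  /-- the unitary applied before the calls (index `0`) and the one after the `t`-th call
  (index `t`) -/
  step : ℕ → Matrix.unitaryGroup (Reg n × Work) ℂ
  /-- the states of the work register on which a call acts -/
  control : ℕ → Work → Bool
  /-- whether a call is one of `A*` instead of `A` -/
  inverse : ℕ → Bool
  /-- the returned number -/
  estimate : Reg n × Work → ℝ

attribute [instance] QueryAlgorithm.fintypeWork QueryAlgorithm.decEqWork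

namespace QueryAlgorithm

variable {n : ℕ}

/-- The unitary of the (controlled) oracle call number `t`. -/
def callMatrix (alg : QueryAlgorithm n) (A : Matrix (Reg n) (Reg n) ℂ) (t : ℕ) :
    Matrix (Reg n × alg.Work) (Reg n × alg.Work) ℂ :=
  Matrix.blockDiagonal fun z : alg.Work =>
    if alg.control t z then (if alg.inverse t then Aᴴ else A) else 1

/-- The state after `t` calls. -/
def state (alg : QueryAlgorithm n) (A : Matrix (Reg n) (Reg n) ℂ) : ℕ → Reg n × alg.Work → ℂ
  | 0 => (alg.step 0).1 *ᵥ Pi.single ((0, fun _ => false), alg.start) 1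
  | t + 1 => (alg.step (t + 1)).1 *ᵥ (alg.callMatrix A t *ᵥ alg.state A t)

/-- The distribution of the outcome of the final measurement. -/
def law (alg : QueryAlgorithm n) (A : Matrix (Reg n) (Reg n) ℂ) (x : Reg n × alg.Work) : ℝ :=
  ‖alg.state A alg.calls x‖ ^ 2

end QueryAlgorithm

/-! ### Resources -/

/-- `∑_{k ≤ d} n.choose k`. -/
def chooseLE (n d : ℕ) : ℕ := ∑ k ∈ Finset.range (d + 1), n.choose k

/-- The lower bound `(1 / p) log₂ (2 C_p ‖g^{(p)}‖ / ε)` for the number of qubits. -/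
def qubitBound (p : ℕ) (Cp : ℝ) (g : ℝ → ℝ) (ε : ℝ) : ℝ :=
  1 / (p : ℝ) * Real.logb 2 (2 * Cp * supNormDeriv p g / ε)

/-- The lower bound `2 C_est / (ε √δ)` for the number of oracle calls. -/
def callBound (Cest δ ε : ℝ) : ℝ := 2 * Cest / (ε * Real.sqrt δ)

end QAE

end

noncomputable section

namespace QAE

/-! ### Multilinear polynomials on bit strings -/

/-! The encoding circuit works because its gates rotate about one axis: on the index block `b` the
angles add up to the multilinear expansion of the angle map, whose coefficients come from Möbius
inversion. The ancilla-1 component at `b` then has modulus √(w_b h(b)), so the amplitude is the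
quadrature value.

Confidence is a triangle inequality plus Chebyshev (`one_sub_le_finProb`): the qubit bound makes the
bias at most ε/2, and the call bound makes the root mean square error at most ε√δ/2.

The estimator with error O(1/M) measures the cosine c = 1 - 2a directly instead of a phase. Let Z be
the ancilla flip, F = 2|e₀⟩⟨e₀| - 1 and G = A F A* Z. On the plane spanned by the two ancilla
components of A e₀ this is the usual Grover iterate, but Z and F do not depend on A, as a query
algorithm requires. The orbit w_j of G, started at Z A e₀, obeys w_{j+2} + w_j = 2c w_{j+1}
(`groverOrbit_add`). Hence the superposition of f(j+1) w_{j+1} ⊗ |j⟩ is nearly an eigenvector, with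
eigenvalue c, of half the adjacency matrix X of a path acting on the work register. The defect
involves only increments of the window f, and the parabola f(i) = i(K+2-i) makes its squared norm at
most 30/(K+1)² (`sum_norm_sq_halfPath_sub_le`). Measuring X in its eigenbasis has exactly this mean
square deviation from c, and (1 - λ)/2 estimates a. Since K is about M/2, the error is O(1/M). -/

theorem monomial_eq_ite {n : ℕ} (S : Finset (Fin n)) (b : Bits n) :
    monomial S b = if ∀ j ∈ S, b j = true then 1 else 0 := by
  unfold monomial
  split_ifs with h
  · exact Finset.prod_eq_one fun j hj => by simp [h j hj]
  · push Not at h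
    obtain ⟨j, hj, hb⟩ := h
    exact Finset.prod_eq_zero hj (by simp [hb])

/-- Expand ∏_{i ∈ S} (1 + x_i) with x_i = 0 on U and -1 off U: the term of T survives only if U ⊆ T,
while the product itself is nonzero only if S ⊆ U. -/
theorem sum_powerset_neg_one_pow_mul_ite_subset {ι : Type*} [DecidableEq ι] (S U : Finset ι) :
    ∑ T ∈ S.powerset, (-1 : ℝ) ^ (S \ T).card * (if U ⊆ T then 1 else 0)
      = if U = S then 1 else 0 := by
  by_cases hUS : U ⊆ S
  · have h := Finset.prod_add (fun _ : ι => (1 : ℝ)) (fun i => if i ∈ U then 0 else -1) S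
    have hterm : ∀ T ∈ S.powerset, (-1 : ℝ) ^ (S \ T).card * (if U ⊆ T then 1 else 0)
        = (∏ _i ∈ T, (1 : ℝ)) * ∏ i ∈ S \ T, (if i ∈ U then 0 else -1) := by
      intro T _
      split_ifs with hU
      · have hprod : ∏ i ∈ S \ T, (if i ∈ U then (0 : ℝ) else -1) = ∏ _i ∈ S \ T, (-1 : ℝ) :=
          Finset.prod_congr rfl fun i hi =>
            if_neg fun hiU => (Finset.mem_sdiff.1 hi).2 (hU hiU)
        simp [hprod]
      · obtain ⟨i, hiU, hiT⟩ := Finset.not_subset.1 hU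
        rw [Finset.prod_eq_zero (Finset.mem_sdiff.2 ⟨hUS hiU, hiT⟩) (by simp [hiU])]
        simp
    rw [Finset.sum_congr rfl hterm, ← h]
    split_ifs with hU
    · exact Finset.prod_eq_one fun i hi => by simp [hU, hi]
    · have : ¬ S ⊆ U := fun hSU => hU (hUS.antisymm hSU)
      obtain ⟨i, hiS, hiU⟩ := Finset.not_subset.1 this
      exact Finset.prod_eq_zero hiS (by simp [hiU])
  · rw [if_neg fun h => hUS h.subset]
    refine Finset.sum_eq_zero fun T hT => ?_
    rw [if_neg fun h => hUS (h.trans (Finset.mem_powerset.1 hT)), mul_zero]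

/-- Möbius inversion recovers the coefficients of a multilinear polynomial. -/
theorem multilinearCoeff_eq {n : ℕ} {f : Bits n → ℝ} {c : Finset (Fin n) → ℝ}
    (hf : ∀ b, f b = ∑ S, c S * monomial S b) (S : Finset (Fin n)) :
    multilinearCoeff f S = c S := by
  unfold multilinearCoeff
  simp only [hf, Finset.mul_sum]
  rw [Finset.sum_comm]
  have h : ∀ U : Finset (Fin n), ∑ T ∈ S.powerset,
      (-1 : ℝ) ^ (S \ T).card * (c U * monomial U fun j => decide (j ∈ T))
        = c U * if U = S then 1 else 0 := by
    intro U
    rw [← sum_powerset_neg_one_pow_mul_ite_subset, Finset.mul_sum]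
    refine Finset.sum_congr rfl fun T _ => ?_
    have : monomial U (fun j => decide (j ∈ T)) = if U ⊆ T then 1 else 0 := by
      rw [monomial_eq_ite]
      simp [Finset.subset_iff]
    rw [this]
    ring
  rw [Finset.sum_congr rfl fun U _ => h U]
  simp

theorem MultilinearDegreeLE.eq_sum {n d : ℕ} {f : Bits n → ℝ} (hf : MultilinearDegreeLE f d)
    (b : Bits n) :
    f b = ∑ S ∈ Finset.univ.filter (fun S : Finset (Fin n) => S.card ≤ d),
      multilinearCoeff f S * monomial S b := by
  obtain ⟨c, hc, hfc⟩ := hf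
  rw [hfc b, Finset.sum_filter]
  refine Finset.sum_congr rfl fun S _ => ?_
  split_ifs with hS
  · rw [multilinearCoeff_eq hfc]
  · rw [hc S (not_le.1 hS), zero_mul]

/-! ### The encoding circuit -/

theorem rotY_zero : rotY 0 = 1 := by
  ext i j
  fin_cases i <;> fin_cases j <;> simp [rotY]

theorem rotY_mul (s t : ℝ) : rotY s * rotY t = rotY (s + t) := by
  have h : (s + t) / 2 = s / 2 + t / 2 := by ring
  ext i j
  fin_cases i <;> fin_cases j <;>
    simp [rotY, h, Matrix.mul_apply, Fin.sum_univ_two, Complex.cos_add, Complex.sin_add] <;> ring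

theorem conjTranspose_rotY (t : ℝ) : (rotY t)ᴴ = rotY (-t) := by
  ext i j
  fin_cases i <;> fin_cases j <;>
    simp [rotY, Matrix.conjTranspose_apply, neg_div, ← Complex.cos_conj, ← Complex.sin_conj,
      map_ofNat]

theorem rotY_mem_unitaryGroup (t : ℝ) : rotY t ∈ Matrix.unitaryGroup (Fin 2) ℂ := by
  rw [Matrix.mem_unitaryGroup_iff, Matrix.star_eq_conjTranspose, conjTranspose_rotY, rotY_mul]
  simp [rotY_zero]

/-- Each gate is block diagonal, rotating block `b` by its angle times a 0/1 monomial. Rotations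
about one axis commute and their angles add, so the order of the gates is immaterial. -/
theorem circuitMatrix_eq_blockDiagonal {n : ℕ} (L : List (Finset (Fin n) × ℝ)) :
    circuitMatrix L = Matrix.blockDiagonal fun b : Bits n =>
      rotY (L.map fun q => q.2 * monomial q.1 b).sum := by
  induction L with
  | nil =>
    simp only [circuitMatrix, List.map_nil, List.prod_nil, List.sum_nil, rotY_zero]
    exact (Matrix.blockDiagonal_one (o := Bits n) (m := Fin 2) (α := ℂ)).symm
  | cons q L ih =>
    have h : circuitMatrix (q :: L) = ctrlRotY q.1 q.2 * circuitMatrix L := by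
      simp [circuitMatrix]
    rw [h, ih, ctrlRotY, ← Matrix.blockDiagonal_mul]
    congr 1
    ext1 b
    rw [List.map_cons, List.sum_cons, ← rotY_mul, monomial_eq_ite]
    split_ifs <;> simp [rotY_zero]

theorem circuitMatrix_monomialCircuit {n d : ℕ} {h : Bits n → ℝ} (hh : h ∈ angleClass n d) :
    circuitMatrix (monomialCircuit d h) = encodingOp h := by
  rw [circuitMatrix_eq_blockDiagonal, encodingOp]
  congr 1
  ext1 b
  rw [hh.2.eq_sum b, monomialCircuit, List.map_map, ← Finset.sum_map_toList]
  rfl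

theorem card_filter_card_le (n d : ℕ) :
    (Finset.univ.filter fun S : Finset (Fin n) => S.card ≤ d).card = chooseLE n d := by
  rw [Finset.card_eq_sum_card_fiberwise (f := Finset.card) (t := Finset.range (d + 1))]
  · refine Finset.sum_congr rfl fun k hk => ?_
    have : {a ∈ Finset.univ.filter fun S : Finset (Fin n) => S.card ≤ d | a.card = k}
        = Finset.powersetCard k Finset.univ := by
      ext S
      have := Finset.mem_range.1 hk
      simp only [Finset.mem_filter, Finset.mem_univ, true_and, Finset.mem_powersetCard,
        Finset.subset_univ]
      omega
    rw [this, Finset.card_powersetCard, Finset.card_univ, Fintype.card_fin]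
  · intro S hS
    simpa [Nat.lt_succ_iff] using hS

theorem length_monomialCircuit {n : ℕ} (d : ℕ) (h : Bits n → ℝ) :
    (monomialCircuit d h).length = chooseLE n d := by
  simp [monomialCircuit, card_filter_card_le]

theorem blockDiagonal_mem_unitaryGroup {m o : Type*} [Fintype m] [DecidableEq m] [Fintype o]
    [DecidableEq o] {B : o → Matrix m m ℂ} (hB : ∀ z, B z ∈ Matrix.unitaryGroup m ℂ) :
    Matrix.blockDiagonal B ∈ Matrix.unitaryGroup (m × o) ℂ := by
  rw [Matrix.mem_unitaryGroup_iff, Matrix.star_eq_conjTranspose,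
    Matrix.blockDiagonal_conjTranspose, ← Matrix.blockDiagonal_mul]
  have : (fun k => B k * (B k)ᴴ) = 1 := by
    ext1 z
    simpa [Matrix.star_eq_conjTranspose] using Matrix.mem_unitaryGroup_iff.1 (hB z)
  rw [this, Matrix.blockDiagonal_one]

theorem encodingOp_mem_unitaryGroup {n : ℕ} (h : Bits n → ℝ) :
    encodingOp h ∈ Matrix.unitaryGroup (Reg n) ℂ :=
  blockDiagonal_mem_unitaryGroup fun _ => rotY_mem_unitaryGroup _

theorem amplitudeOracle_mem_unitaryGroup {n : ℕ} (h : Bits n → ℝ)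
    {V : Matrix (Bits n) (Bits n) ℂ} (hV : V ∈ Matrix.unitaryGroup (Bits n) ℂ) :
    amplitudeOracle h V ∈ Matrix.unitaryGroup (Reg n) ℂ :=
  mul_mem (encodingOp_mem_unitaryGroup h) (Matrix.kronecker_mem_unitary (one_mem _) hV)

/-- At `(1, b)` the state is sin(Θ(b)/2) √w_b, and halving the angle map leaves sin(arcsin √h) = √h.
-/
theorem amplitude_amplitudeOracle {n : ℕ} (R : QuadratureRule n) {g : ℝ → ℝ}
    (hg : ∀ b, R.samples g b ∈ Set.Icc (0 : ℝ) 1) {V : Matrix (Bits n) (Bits n) ℂ}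
    (hV : R.Prepares V) :
    amplitude (amplitudeOracle (R.samples g) V) = R.approx g := by
  unfold amplitude ancillaProb QuadratureRule.approx
  refine Finset.sum_congr rfl fun b _ => ?_
  have h : (amplitudeOracle (R.samples g) V *ᵥ initState n) (1, b)
      = ((Real.sin (Real.arcsin √(R.samples g b)) * √(R.weight b) : ℝ) : ℂ) := by
    rw [initState, Matrix.mulVec_single_one, Matrix.col_apply, amplitudeOracle, Matrix.mul_apply,
      Fintype.sum_prod_type]
    simp only [encodingOp, Matrix.blockDiagonal_apply, Matrix.kroneckerMap_apply,
      Fin.sum_univ_two, hV.2]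
    simp [rotY, angleMap]
  have h0 := hg b
  rw [h, Complex.norm_real, Real.norm_eq_abs, sq_abs, mul_pow, Real.sq_sqrt (R.weight_nonneg b),
    Real.sin_arcsin (by linarith [Real.sqrt_nonneg (R.samples g b)])
      (Real.sqrt_le_one.2 h0.2), Real.sq_sqrt h0.1, mul_comm]
  rfl

/-! ### Unitaries and norms -/

theorem star_dotProduct_self {ι : Type*} [Fintype ι] (v : ι → ℂ) :
    star v ⬝ᵥ v = ((∑ x, ‖v x‖ ^ 2 : ℝ) : ℂ) := by
  simp [dotProduct, Complex.conj_mul']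

theorem sum_norm_sq_mulVec {ι : Type*} [Fintype ι] [DecidableEq ι] {U : Matrix ι ι ℂ}
    (hU : U ∈ Matrix.unitaryGroup ι ℂ) (v : ι → ℂ) :
    ∑ x, ‖(U *ᵥ v) x‖ ^ 2 = ∑ x, ‖v x‖ ^ 2 := by
  have h : star (U *ᵥ v) ⬝ᵥ (U *ᵥ v) = star v ⬝ᵥ v := by
    rw [Matrix.star_mulVec, Matrix.dotProduct_mulVec, Matrix.vecMul_vecMul,
      ← Matrix.star_eq_conjTranspose, Matrix.mem_unitaryGroup_iff'.1 hU, Matrix.vecMul_one]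
  rw [star_dotProduct_self, star_dotProduct_self] at h
  exact_mod_cast h

theorem reflection_mem_unitaryGroup {n : ℕ} (v : Reg n → ℂ) :
    reflection v ∈ Matrix.unitaryGroup (Reg n) ℂ := by
  have hH : star (reflection v) = reflection v := by
    rw [Matrix.star_eq_conjTranspose, reflection, Matrix.conjTranspose_sub,
      Matrix.conjTranspose_one, Matrix.conjTranspose_smul, Matrix.conjTranspose_vecMulVec,
      star_star, star_dotProduct_self]
    simp
  rw [Matrix.mem_unitaryGroup_iff, hH]
  have hP : Matrix.vecMulVec v (star v) * Matrix.vecMulVec v (star v)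
      = (star v ⬝ᵥ v) • Matrix.vecMulVec v (star v) := by
    rw [Matrix.vecMulVec_mul_vecMulVec]
    ext i j
    simp [Matrix.vecMulVec_apply]
    ring
  unfold reflection
  rw [sub_mul, mul_sub, mul_sub, one_mul, mul_one, one_mul, smul_mul_smul_comm, hP, smul_smul]
  -- For v = 0 the coefficient is 2/0 = 0 and the reflection is the identity.
  by_cases h0 : star v ⬝ᵥ v = 0
  · simp [h0]
  · have : 2 / (star v ⬝ᵥ v) * (2 / (star v ⬝ᵥ v)) * (star v ⬝ᵥ v)
        = 2 / (star v ⬝ᵥ v) + 2 / (star v ⬝ᵥ v) := by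
      field_simp
      ring
    rw [this, add_smul]
    abel

theorem groverIterate_mem_unitaryGroup {n : ℕ} {A : Matrix (Reg n) (Reg n) ℂ}
    (hA : A ∈ Matrix.unitaryGroup (Reg n) ℂ) :
    groverIterate A ∈ Matrix.unitaryGroup (Reg n) ℂ :=
  mul_mem (mul_mem (mul_mem hA (reflection_mem_unitaryGroup _)) (Unitary.star_mem hA))
    (reflection_mem_unitaryGroup _)

theorem sum_norm_sq_single {ι : Type*} [Fintype ι] [DecidableEq ι] (i : ι) :
    ∑ x, ‖(Pi.single i 1 : ι → ℂ) x‖ ^ 2 = 1 := by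
  rw [Finset.sum_eq_single i] <;> simp +contextual

theorem ancillaProb_nonneg {n : ℕ} (v : Reg n → ℂ) : 0 ≤ ancillaProb v := by
  unfold ancillaProb
  positivity

theorem ancillaProb_le {n : ℕ} (v : Reg n → ℂ) : ancillaProb v ≤ ∑ x, ‖v x‖ ^ 2 := by
  rw [Fintype.sum_prod_type, Fin.sum_univ_two]
  exact le_add_of_nonneg_left (by positivity)

theorem levelProb_mem_Icc {n : ℕ} {A : Matrix (Reg n) (Reg n) ℂ}
    (hA : A ∈ Matrix.unitaryGroup (Reg n) ℂ) (k : ℕ) :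
    levelProb A k ∈ Set.Icc (0 : ℝ) 1 := by
  refine ⟨ancillaProb_nonneg _, (ancillaProb_le _).trans_eq ?_⟩
  rw [sum_norm_sq_mulVec (mul_mem (pow_mem (groverIterate_mem_unitaryGroup hA) k) hA)]
  exact sum_norm_sq_single _

/-! ### The outcome distributions -/

theorem Schedule.law_nonneg {n : ℕ} (S : Schedule) {A : Matrix (Reg n) (Reg n) ℂ}
    (hA : A ∈ Matrix.unitaryGroup (Reg n) ℂ) (ω : S.Record) : 0 ≤ S.law A ω := by
  refine Finset.prod_nonneg fun k _ => Finset.prod_nonneg fun s _ => ?_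
  have := levelProb_mem_Icc hA k
  split_ifs
  exacts [this.1, sub_nonneg.2 this.2]

theorem Schedule.sum_law {n : ℕ} (S : Schedule) (A : Matrix (Reg n) (Reg n) ℂ) :
    ∑ ω, S.law A ω = 1 := by
  unfold Schedule.law
  rw [← Fintype.prod_sum fun (k : S.levels) (f : Fin (S.shots k) → Bool) =>
    ∏ s, if f s then levelProb A k else 1 - levelProb A k]
  refine Finset.prod_eq_one fun k _ => ?_
  rw [← Fintype.prod_sum fun (_ : Fin (S.shots k)) (b : Bool) =>
    if b then levelProb A k else 1 - levelProb A k]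
  simp

namespace QueryAlgorithm

variable {n : ℕ} (alg : QueryAlgorithm n) {A : Matrix (Reg n) (Reg n) ℂ}

theorem callMatrix_mem_unitaryGroup (hA : A ∈ Matrix.unitaryGroup (Reg n) ℂ) (t : ℕ) :
    alg.callMatrix A t ∈ Matrix.unitaryGroup (Reg n × alg.Work) ℂ := by
  refine blockDiagonal_mem_unitaryGroup fun z => ?_
  split_ifs
  exacts [Unitary.star_mem hA, hA, one_mem _]

theorem sum_norm_sq_state (hA : A ∈ Matrix.unitaryGroup (Reg n) ℂ) (t : ℕ) :
    ∑ x, ‖alg.state A t x‖ ^ 2 = 1 := by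
  induction t with
  | zero => exact (sum_norm_sq_mulVec (alg.step 0).2 _).trans (sum_norm_sq_single _)
  | succ t ih =>
    exact ((sum_norm_sq_mulVec (alg.step (t + 1)).2 _).trans
      (sum_norm_sq_mulVec (alg.callMatrix_mem_unitaryGroup hA t) _)).trans ih

theorem law_nonneg (x : Reg n × alg.Work) : 0 ≤ alg.law A x := sq_nonneg _

theorem sum_law (hA : A ∈ Matrix.unitaryGroup (Reg n) ℂ) : ∑ x, alg.law A x = 1 :=
  alg.sum_norm_sq_state hA _

end QueryAlgorithm

/-! ### From root mean square errors to confidence -/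

/-- Chebyshev's inequality for an estimator of a quantity with a bias. -/
theorem one_sub_le_finProb {Ω : Type} [Fintype Ω] {w est : Ω → ℝ} (hw : ∀ ω, 0 ≤ w ω)
    (hsum : ∑ ω, w ω = 1) {I q ε δ : ℝ} (hε : 0 < ε) (hδ : 0 < δ) (hq : |I - q| ≤ ε / 2)
    (hrms : rmsError w est q ≤ ε * √δ / 2) :
    1 - δ ≤ finProb w {ω | |I - est ω| ≤ ε} := by
  set E : Set Ω := {ω | |I - est ω| ≤ ε}
  have hmse : ∑ ω, w ω * (est ω - q) ^ 2 ≤ (ε / 2) ^ 2 * δ := by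
    have h := Real.sqrt_le_iff.1 hrms
    calc _ ≤ _ := h.2
      _ = (ε / 2) ^ 2 * √δ ^ 2 := by ring
      _ = _ := by rw [Real.sq_sqrt hδ.le]
  -- Chebyshev pointwise: off `E` the total error exceeds ε while the bias is at most ε/2, so the
  -- estimator misses q by at least ε/2.
  have hterm : ∀ ω, (ε / 2) ^ 2 * (w ω - E.indicator w ω) ≤ w ω * (est ω - q) ^ 2 := by
    intro ω
    by_cases hω : ω ∈ E
    · rw [Set.indicator_of_mem hω, sub_self, mul_zero]
      exact mul_nonneg (hw ω) (sq_nonneg _)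
    · rw [Set.indicator_of_notMem hω, sub_zero, mul_comm]
      refine mul_le_mul_of_nonneg_left ?_ (hw ω)
      have h1 : ε < |I - est ω| := not_le.1 hω
      have h2 : |I - est ω| ≤ |I - q| + |q - est ω| := abs_sub_le _ _ _
      rw [abs_sub_comm q] at h2
      rw [← sq_abs (est ω - q)]
      exact pow_le_pow_left₀ (by positivity) (by linarith) 2
  have h := Finset.sum_le_sum fun ω (_ : ω ∈ Finset.univ) => hterm ω
  rw [← Finset.mul_sum, Finset.sum_sub_distrib, hsum] at h
  have h3 : 1 - ∑ ω, E.indicator w ω ≤ δ :=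
    le_of_mul_le_mul_left (h.trans hmse) (by positivity)
  unfold finProb
  linarith

theorem supNormDeriv_nonneg (p : ℕ) (g : ℝ → ℝ) : 0 ≤ supNormDeriv p g :=
  Real.iSup_nonneg fun _ => abs_nonneg _

theorem discretisation_error_le {p n : ℕ} {Cp ε s : ℝ} (hp : 1 ≤ p) (hCp : 0 < Cp) (hε : 0 < ε)
    (hs : 0 ≤ s) (h : 1 / (p : ℝ) * Real.logb 2 (2 * Cp * s / ε) ≤ n) :
    Cp * ((2 : ℝ) ^ (p * n))⁻¹ * s ≤ ε / 2 := by
  -- For s = 0 the convention log 0 = 0 makes the hypothesis vacuous, and the left-hand side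
  -- vanishes.
  rcases hs.eq_or_lt with rfl | hs
  · simpa using (half_pos hε).le
  have hp0 : (0 : ℝ) < p := by exact_mod_cast hp
  have h1 : Real.logb 2 (2 * Cp * s / ε) ≤ ((p * n : ℕ) : ℝ) := by
    rw [one_div, inv_mul_le_iff₀ hp0] at h
    exact_mod_cast h
  rw [Real.logb_le_iff_le_rpow one_lt_two (by positivity), Real.rpow_natCast,
    div_le_iff₀ hε] at h1
  have h2 : (0 : ℝ) < 2 ^ (p * n) := by positivity
  rw [mul_assoc, mul_comm _ s, ← mul_assoc, ← div_eq_mul_inv, div_le_iff₀ h2]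
  linarith

theorem rms_le_of_callBound_le {C δ ε r : ℝ} {M : ℕ} (hC : 0 < C) (hδ : 0 < δ) (hε : 0 < ε)
    (hr : r ≤ C / M) (hM : callBound C δ ε ≤ M) : r ≤ ε * √δ / 2 := by
  have hd : 0 < ε * √δ := mul_pos hε (Real.sqrt_pos.2 hδ)
  unfold callBound at hM
  have hM0 : (0 : ℝ) < M := lt_of_lt_of_le (by positivity) hM
  refine hr.trans ?_
  rw [div_le_iff₀ hd] at hM
  rw [div_le_iff₀ hM0]
  linarith

/-! ### Linear algebra for the estimation procedure -/

/-- Extend the unit vector to an orthonormal basis and take its matrix in the standard basis. -/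
theorem exists_unitary_column {ι : Type*} [Fintype ι] [DecidableEq ι] (v : ι → ℂ) (i : ι)
    (hv : ∑ j, ‖v j‖ ^ 2 = 1) :
    ∃ U ∈ Matrix.unitaryGroup ι ℂ, ∀ j, U j i = v j := by
  have hnorm : ‖WithLp.toLp 2 v‖ = 1 := by
    rw [EuclideanSpace.norm_eq]
    simp [hv]
  have hon : Orthonormal ℂ
      (({i} : Set ι).domRestrict fun _ : ι => (WithLp.toLp 2 v : EuclideanSpace ℂ ι)) :=
    ⟨fun _ => hnorm, fun x y hxy => absurd (Subsingleton.elim x y) hxy⟩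
  obtain ⟨b, hb⟩ := hon.exists_orthonormalBasis_extension_of_card_eq finrank_euclideanSpace
  refine ⟨_, (EuclideanSpace.basisFun ι ℂ).toMatrix_orthonormalBasis_mem_unitary b, fun j => ?_⟩
  have := hb i rfl
  simp [Module.Basis.toMatrix_apply, this]

theorem blockDiagonal_mulVec_apply {m o : Type*} [Fintype m] [Fintype o] [DecidableEq o]
    (B : o → Matrix m m ℂ) (f : m × o → ℂ) (x : m × o) :
    (Matrix.blockDiagonal B *ᵥ f) x = (B x.2 *ᵥ fun p => f (p, x.2)) x.1 := by
  simp [Matrix.mulVec, dotProduct, Fintype.sum_prod_type, Matrix.blockDiagonal_apply]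

theorem one_kronecker_mulVec_apply {m o : Type*} [Fintype m] [Fintype o] [DecidableEq m]
    (U : Matrix o o ℂ) (f : m × o → ℂ) (x : m × o) :
    (((1 : Matrix m m ℂ) ⊗ₖ U) *ᵥ f) x = (U *ᵥ fun z => f (x.1, z)) x.2 := by
  simp [Matrix.mulVec, dotProduct, Fintype.sum_prod_type, Matrix.one_apply, ite_mul]

theorem diagonal_mem_unitaryGroup {ι : Type*} [Fintype ι] [DecidableEq ι] {D : ι → ℂ}
    (hD : ∀ x, D x = 1 ∨ D x = -1) : Matrix.diagonal D ∈ Matrix.unitaryGroup ι ℂ := by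
  rw [Matrix.mem_unitaryGroup_iff, Matrix.star_eq_conjTranspose, Matrix.diagonal_conjTranspose,
    Matrix.diagonal_mul_diagonal, ← Matrix.diagonal_one]
  congr 1
  ext1 x
  rcases hD x with h | h <;> simp [h]

/-- The mean square deviation of the measured eigenvalue of a Hermitian matrix from a number. -/
theorem sum_norm_sq_mul_eigenvalues_sub {ι : Type*} [Fintype ι] [DecidableEq ι]
    {X : Matrix ι ι ℂ} (hX : X.IsHermitian) (ψ : ι → ℂ) (c : ℝ) :
    ∑ k, ‖((star hX.eigenvectorUnitary).1 *ᵥ ψ) k‖ ^ 2 * (hX.eigenvalues k - c) ^ 2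
      = ∑ j, ‖(X *ᵥ ψ) j - c * ψ j‖ ^ 2 := by
  have h1 : (star hX.eigenvectorUnitary).1 * X
      = Matrix.diagonal (RCLike.ofReal ∘ hX.eigenvalues) * (star hX.eigenvectorUnitary).1 := by
    rw [← hX.conjStarAlgAut_star_eigenvectorUnitary, Unitary.conjStarAlgAut_star_apply]
    rw [mul_assoc, Unitary.coe_star, Unitary.mul_star_self_of_mem hX.eigenvectorUnitary.2, mul_one]
  -- The unitary U* diagonalises X, so U*(X - c)ψ = (D - c)U*ψ, and U* preserves the norm of (X -
  -- c)ψ.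
  have h2 := sum_norm_sq_mulVec (star hX.eigenvectorUnitary).2 (X *ᵥ ψ - (c : ℂ) • ψ)
  simp only [Pi.sub_apply, Pi.smul_apply, smul_eq_mul] at h2
  rw [← h2]
  refine Finset.sum_congr rfl fun k _ => ?_
  rw [Matrix.mulVec_sub, Matrix.mulVec_smul, Matrix.mulVec_mulVec, h1, ← Matrix.mulVec_mulVec,
    Pi.sub_apply, Matrix.mulVec_diagonal, Pi.smul_apply, smul_eq_mul, ← sub_mul, norm_mul, mul_pow,
    mul_comm]
  congr 1
  change _ = ‖((hX.eigenvalues k : ℝ) : ℂ) - (c : ℂ)‖ ^ 2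
  rw [← Complex.ofReal_sub, Complex.norm_real, Real.norm_eq_abs, sq_abs]

/-- Half the adjacency matrix of the path with `K + 1` vertices. -/
def halfPath (K : ℕ) : Matrix (Fin (K + 1)) (Fin (K + 1)) ℂ :=
  Matrix.of fun i j =>
    1 / 2 * ((if (j : ℕ) + 1 = i then 1 else 0) + if (j : ℕ) = i + 1 then 1 else 0)

theorem isHermitian_halfPath (K : ℕ) : (halfPath K).IsHermitian := by
  ext i j
  simp only [halfPath, Matrix.conjTranspose_apply, Matrix.of_apply]
  rw [add_comm]
  split_ifs <;> first | omega | simp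

/-- Vertex i carries f(i+1). The zeros at 0 and K+2 stand for the missing neighbours of the two end
vertices, so one formula holds on the whole path. -/
theorem halfPath_mulVec {K : ℕ} {f : ℕ → ℂ} (h0 : f 0 = 0) (hK : f (K + 2) = 0)
    (j : Fin (K + 1)) :
    (halfPath K *ᵥ fun i => f (i + 1)) j = 1 / 2 * (f j + f (j + 2)) := by
  have h1 : ∑ i : Fin (K + 1), (if (i : ℕ) + 1 = j then f (i + 1) else 0) = f j := by
    rw [Fin.sum_univ_eq_sum_range fun i => if i + 1 = (j : ℕ) then f (i + 1) else 0]
    rcases Nat.eq_zero_or_eq_succ_pred (j : ℕ) with hj | hj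
    · rw [hj, h0]
      exact Finset.sum_eq_zero fun i _ => by simp
    · rw [Finset.sum_eq_single ((j : ℕ) - 1)]
      · rw [if_pos (by omega)]
        congr 1
        omega
      · intro i _ hi
        rw [if_neg (by omega)]
      · intro h
        exact absurd (Finset.mem_range.2 (by omega)) h
  have h2 : ∑ i : Fin (K + 1), (if (i : ℕ) = j + 1 then f (i + 1) else 0) = f (j + 2) := by
    rw [Fin.sum_univ_eq_sum_range fun i => if i = (j : ℕ) + 1 then f (i + 1) else 0,
      Finset.sum_ite_eq']
    split_ifs with h
    · rfl
    · have : (j : ℕ) = K := by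
        have := j.2
        rw [Finset.mem_range] at h
        omega
      rw [this, hK]
  change ∑ i, halfPath K j i * f (i + 1) = _
  rw [show f j + f (j + 2) = _ + _ from (congrArg₂ (· + ·) h1 h2).symm,
    ← Finset.sum_add_distrib, Finset.mul_sum]
  refine Finset.sum_congr rfl fun i _ => ?_
  simp only [halfPath, Matrix.of_apply, mul_assoc, add_mul, ite_mul, one_mul, zero_mul]

/-- The amplitude profile of the work register, vanishing at `0` and `K + 2`. -/
def profile (K i : ℕ) : ℝ := i * (K + 2 - i)

/-- The squared norm of the profile. -/
def profileNormSq (K : ℕ) : ℝ := ∑ j : Fin (K + 1), profile K (j + 1) ^ 2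

theorem sum_sq_mul_sub_sq (y : ℝ) (k : ℕ) :
    ∑ i ∈ Finset.range k, ((i + 1 : ℕ) * (y - (i + 1 : ℕ)) : ℝ) ^ 2
      = y ^ 2 * (k * (k + 1) * (2 * k + 1) / 6) - 2 * y * (k ^ 2 * (k + 1) ^ 2 / 4)
        + k * (k + 1) * (2 * k + 1) * (3 * k ^ 2 + 3 * k - 1) / 30 := by
  induction k with
  | zero => simp
  | succ k ih =>
    rw [Finset.sum_range_succ, ih]
    push_cast
    ring

/-- With L = K + 2 the sum is (L⁵ - L)/30, the discrete analogue of ∫₀ᴸ x²(L - x)² dx = L⁵/30. Its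
excess over (L - 1)⁵/30 has nonnegative coefficients in K. -/
theorem le_profileNormSq (K : ℕ) : ((K : ℝ) + 1) ^ 5 / 30 ≤ profileNormSq K := by
  unfold profileNormSq profile
  rw [Fin.sum_univ_eq_sum_range fun j => ((j + 1 : ℕ) * ((K : ℝ) + 2 - (j + 1 : ℕ))) ^ 2,
    sum_sq_mul_sub_sq, ← sub_nonneg]
  have : (0 : ℝ) ≤ K := K.cast_nonneg
  push_cast
  ring_nf
  positivity

theorem profileNormSq_pos (K : ℕ) : 0 < profileNormSq K :=
  lt_of_lt_of_le (by positivity) (le_profileNormSq K)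

/-- The normalised profile. -/
def windowAmp (K i : ℕ) : ℂ := ((profile K i / √(profileNormSq K) : ℝ) : ℂ)

theorem sum_norm_sq_windowAmp (K : ℕ) : ∑ j : Fin (K + 1), ‖windowAmp K (j + 1)‖ ^ 2 = 1 := by
  have h := profileNormSq_pos K
  simp only [windowAmp, Complex.norm_real, Real.norm_eq_abs, sq_abs, div_pow, Real.sq_sqrt h.le]
  rw [← Finset.sum_div]
  exact div_self h.ne'

theorem abs_profile_sub_le {K i : ℕ} (hi : i ≤ K + 1) :
    |profile K (i + 1) - profile K i| ≤ K + 1 := by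
  have h : (i : ℝ) ≤ K + 1 := by exact_mod_cast hi
  have h0 : (0 : ℝ) ≤ i := i.cast_nonneg
  -- The increment equals K + 1 - 2i.
  unfold profile
  push_cast
  rw [abs_le]
  constructor <;> linarith

theorem norm_sq_half_add_le {a b L : ℝ} (ha : |a| ≤ L) (hb : |b| ≤ L) (x y : ℂ) :
    ‖1 / 2 * ((a : ℂ) * x + (b : ℂ) * y)‖ ^ 2 ≤ L ^ 2 * ((‖x‖ ^ 2 + ‖y‖ ^ 2) / 2) := by
  have hL : 0 ≤ L := (abs_nonneg a).trans ha
  have h1 : ‖1 / 2 * ((a : ℂ) * x + (b : ℂ) * y)‖ ≤ L * ((‖x‖ + ‖y‖) / 2) := by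
    rw [norm_mul]
    have h2 : ‖(a : ℂ) * x + (b : ℂ) * y‖ ≤ L * ‖x‖ + L * ‖y‖ := by
      refine (norm_add_le _ _).trans ?_
      rw [norm_mul, norm_mul, Complex.norm_real, Complex.norm_real]
      exact add_le_add (mul_le_mul_of_nonneg_right ha (norm_nonneg _))
        (mul_le_mul_of_nonneg_right hb (norm_nonneg _))
    have h3 : ‖(1 / 2 : ℂ)‖ = 1 / 2 := by simp
    rw [h3]
    linarith
  refine (pow_le_pow_left₀ (norm_nonneg _) h1 2).trans ?_
  rw [mul_pow]
  refine mul_le_mul_of_nonneg_left ?_ (sq_nonneg L)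
  linarith [sq_nonneg (‖x‖ - ‖y‖)]

/-- A sequence of unit vectors satisfying a Chebyshev recurrence, weighted by the window, is an
approximate eigenvector of the half path. -/
theorem sum_norm_sq_halfPath_sub_le {ι : Type*} [Fintype ι] {K : ℕ} {c : ℝ} {w : ℕ → ι → ℂ}
    (hw : ∀ j, ∑ p, ‖w j p‖ ^ 2 = 1)
    (hrec : ∀ j p, w (j + 2) p + w j p = 2 * c * w (j + 1) p) :
    ∑ p, ∑ j : Fin (K + 1),
      ‖(halfPath K *ᵥ fun i => windowAmp K (i + 1) * w (i + 1) p) j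
          - c * (windowAmp K (j + 1) * w (j + 1) p)‖ ^ 2
      ≤ 30 / ((K : ℝ) + 1) ^ 2 := by
  have hN := profileNormSq_pos K
  set N := profileNormSq K with hNdef
  have hterm : ∀ p, ∀ j : Fin (K + 1),
      ‖(halfPath K *ᵥ fun i => windowAmp K (i + 1) * w (i + 1) p) j
          - c * (windowAmp K (j + 1) * w (j + 1) p)‖ ^ 2
        ≤ N⁻¹ * (((K : ℝ) + 1) ^ 2 * ((‖w j p‖ ^ 2 + ‖w (j + 2) p‖ ^ 2) / 2)) := by
    intro p j
    have hj : (j : ℕ) ≤ K := Nat.lt_succ_iff.1 j.2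
    rw [halfPath_mulVec (f := fun i => windowAmp K i * w i p) (by simp [windowAmp, profile])
      (by simp [windowAmp, profile])]
    -- The recurrence writes c w_{j+1} as the half sum of w_j and w_{j+2}, so only increments of the
    -- window remain.
    have heq : 1 / 2 * (windowAmp K j * w j p + windowAmp K (j + 2) * w (j + 2) p)
          - c * (windowAmp K (j + 1) * w (j + 1) p)
        = ((√N)⁻¹ : ℝ) * (1 / 2 * (((profile K j - profile K (j + 1) : ℝ) : ℂ) * w j p
          + ((profile K (j + 2) - profile K (j + 1) : ℝ) : ℂ) * w (j + 2) p)) := by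
      have h := hrec j p
      simp only [windowAmp, ← hNdef]
      push_cast
      linear_combination ((profile K (j + 1) : ℂ) / (2 * (√N : ℝ))) * h
    rw [heq, norm_mul, mul_pow, Complex.norm_real, Real.norm_eq_abs, sq_abs, inv_pow,
      Real.sq_sqrt hN.le]
    refine mul_le_mul_of_nonneg_left (norm_sq_half_add_le ?_ ?_ _ _) (inv_nonneg.2 hN.le)
    · rw [abs_sub_comm]
      exact abs_profile_sub_le (by omega)
    · exact abs_profile_sub_le (by omega)
  refine (Finset.sum_le_sum fun p _ => Finset.sum_le_sum fun j _ => hterm p j).trans ?_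
  rw [Finset.sum_comm]
  have hsum : ∀ j : Fin (K + 1),
      ∑ p, N⁻¹ * (((K : ℝ) + 1) ^ 2 * ((‖w j p‖ ^ 2 + ‖w (j + 2) p‖ ^ 2) / 2))
        = N⁻¹ * ((K : ℝ) + 1) ^ 2 := by
    intro j
    rw [← Finset.mul_sum, ← Finset.mul_sum, ← Finset.sum_div, Finset.sum_add_distrib, hw, hw]
    norm_num
  rw [Finset.sum_congr rfl fun j _ => hsum j, Finset.sum_const, Finset.card_univ,
    Fintype.card_fin, nsmul_eq_mul]
  have hK : (0 : ℝ) < (K : ℝ) + 1 := by positivity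
  -- Each of the K + 1 vertices contributes (K+1)²/N, and N is of order (K+1)⁵.
  have h5 := le_profileNormSq K
  rw [← hNdef] at h5
  push_cast
  rw [inv_mul_eq_div, ← mul_div_assoc, div_le_div_iff₀ hN (by positivity)]
  calc ((K : ℝ) + 1) * ((K : ℝ) + 1) ^ 2 * ((K : ℝ) + 1) ^ 2
      = 30 * (((K : ℝ) + 1) ^ 5 / 30) := by ring
    _ ≤ 30 * N := by linarith

/-! ### The Grover orbit -/

/-- The phase flip of the states with ancilla `1`. -/
def ancillaFlip (n : ℕ) : Matrix (Reg n) (Reg n) ℂ :=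
  Matrix.diagonal fun x => if x.1 = 1 then -1 else 1

/-- The phase flip of all basis states but the initial one. -/
def initFlip (n : ℕ) : Matrix (Reg n) (Reg n) ℂ :=
  Matrix.diagonal fun x => if x = (0, fun _ => false) then 1 else -1

theorem ancillaFlip_mem_unitaryGroup (n : ℕ) :
    ancillaFlip n ∈ Matrix.unitaryGroup (Reg n) ℂ := by
  refine diagonal_mem_unitaryGroup fun x => ?_
  split_ifs <;> simp

theorem initFlip_mem_unitaryGroup (n : ℕ) : initFlip n ∈ Matrix.unitaryGroup (Reg n) ℂ := by
  refine diagonal_mem_unitaryGroup fun x => ?_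
  split_ifs <;> simp

theorem initFlip_mulVec {n : ℕ} (x : Reg n → ℂ) :
    initFlip n *ᵥ x = (2 * x (0, fun _ => false)) • initState n - x := by
  ext y
  simp only [initFlip, Matrix.mulVec_diagonal, Pi.sub_apply, Pi.smul_apply, initState,
    Pi.single_apply, smul_eq_mul]
  split_ifs with h
  · rw [h]
    ring
  · ring

/-- One Grover step, the reflection being that in the ancilla. -/
def groverStep {n : ℕ} (A : Matrix (Reg n) (Reg n) ℂ) : Matrix (Reg n) (Reg n) ℂ :=
  A * initFlip n * Aᴴ * ancillaFlip n

/-- The orbit of the Grover step, starting one step before `A e₀`. -/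
def groverOrbit {n : ℕ} (A : Matrix (Reg n) (Reg n) ℂ) (j : ℕ) : Reg n → ℂ :=
  groverStep A ^ j *ᵥ (ancillaFlip n *ᵥ (A *ᵥ initState n))

section

variable {n : ℕ} {A : Matrix (Reg n) (Reg n) ℂ}

theorem groverOrbit_succ (j : ℕ) :
    groverOrbit A (j + 1) = groverStep A *ᵥ groverOrbit A j := by
  rw [groverOrbit, groverOrbit, Matrix.mulVec_mulVec _ (groverStep A), pow_succ']

theorem sum_norm_sq_groverOrbit (hA : A ∈ Matrix.unitaryGroup (Reg n) ℂ) (j : ℕ) :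
    ∑ p, ‖groverOrbit A j p‖ ^ 2 = 1 := by
  have hG : groverStep A ∈ Matrix.unitaryGroup (Reg n) ℂ :=
    mul_mem (mul_mem (mul_mem hA (initFlip_mem_unitaryGroup n)) (Unitary.star_mem hA))
      (ancillaFlip_mem_unitaryGroup n)
  rw [groverOrbit, sum_norm_sq_mulVec (pow_mem hG j),
    sum_norm_sq_mulVec (ancillaFlip_mem_unitaryGroup n), sum_norm_sq_mulVec hA]
  exact sum_norm_sq_single _

theorem ancillaFlip_mulVec_self (x : Reg n → ℂ) :
    ancillaFlip n *ᵥ (ancillaFlip n *ᵥ x) = x := by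
  ext y
  simp only [ancillaFlip, Matrix.mulVec_diagonal]
  split_ifs <;> simp

theorem conjTranspose_mulVec_mulVec (hA : A ∈ Matrix.unitaryGroup (Reg n) ℂ) (x : Reg n → ℂ) :
    Aᴴ *ᵥ (A *ᵥ x) = x := by
  rw [Matrix.mulVec_mulVec, ← Matrix.star_eq_conjTranspose, Matrix.mem_unitaryGroup_iff'.1 hA,
    Matrix.one_mulVec]

theorem mulVec_conjTranspose_mulVec (hA : A ∈ Matrix.unitaryGroup (Reg n) ℂ) (x : Reg n → ℂ) :
    A *ᵥ (Aᴴ *ᵥ x) = x := by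
  rw [Matrix.mulVec_mulVec, ← Matrix.star_eq_conjTranspose, Matrix.mem_unitaryGroup_iff.1 hA,
    Matrix.one_mulVec]

/-- The flips cancel in G Z A e₀ = A F e₀, and F fixes e₀. Starting at index 0 gives A e₀ a
predecessor, so that the three-term recurrence holds at the first vertex too. -/
theorem groverOrbit_one (hA : A ∈ Matrix.unitaryGroup (Reg n) ℂ) :
    groverOrbit A 1 = A *ᵥ initState n := by
  rw [groverOrbit, pow_one, groverStep, ← Matrix.mulVec_mulVec, ← Matrix.mulVec_mulVec,
    ancillaFlip_mulVec_self, conjTranspose_mulVec_mulVec hA, ← Matrix.mulVec_mulVec,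
    initFlip_mulVec]
  congr 1
  simp [initState, two_smul]

/-- The overlap of `A e₀` with its image under the ancilla flip. -/
theorem conjTranspose_mulVec_ancillaFlip_apply (hA : A ∈ Matrix.unitaryGroup (Reg n) ℂ) :
    (Aᴴ *ᵥ (ancillaFlip n *ᵥ (A *ᵥ initState n))) (0, fun _ => false)
      = ((1 - 2 * amplitude A : ℝ) : ℂ) := by
  have h1 := sum_norm_sq_mulVec hA (initState n)
  rw [initState, sum_norm_sq_single, ← initState, Fintype.sum_prod_type, Fin.sum_univ_two] at h1
  have h2 : (1 - 2 * amplitude A : ℝ) = ∑ b, ‖(A *ᵥ initState n) (0, b)‖ ^ 2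
      - ∑ b, ‖(A *ᵥ initState n) (1, b)‖ ^ 2 := by
    rw [← h1]
    unfold amplitude ancillaProb
    ring
  have h3 : ∀ x, A x (0, fun _ => false) = (A *ᵥ initState n) x := by
    intro x
    rw [initState, Matrix.mulVec_single_one]
    rfl
  rw [h2, Matrix.mulVec, dotProduct, Fintype.sum_prod_type, Fin.sum_univ_two]
  simp only [Matrix.conjTranspose_apply, h3, ancillaFlip, Matrix.mulVec_diagonal]
  push_cast
  simp [← Complex.conj_mul', sub_eq_add_neg]

/-- By the formula for F, G A e₀ = 2⟨A e₀, Z A e₀⟩ A e₀ - Z A e₀, and the overlap is 1 - 2a.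
Applying powers of G gives the other indices. -/
theorem groverOrbit_add (hA : A ∈ Matrix.unitaryGroup (Reg n) ℂ) (j : ℕ) :
    groverOrbit A (j + 2) + groverOrbit A j
      = (2 * ((1 - 2 * amplitude A : ℝ) : ℂ)) • groverOrbit A (j + 1) := by
  induction j with
  | zero =>
    rw [groverOrbit_succ, zero_add, groverOrbit_one hA, groverStep, ← Matrix.mulVec_mulVec,
      ← Matrix.mulVec_mulVec, ← Matrix.mulVec_mulVec, initFlip_mulVec,
      conjTranspose_mulVec_ancillaFlip_apply hA, Matrix.mulVec_sub, Matrix.mulVec_smul,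
      mulVec_conjTranspose_mulVec hA, groverOrbit, pow_zero, Matrix.one_mulVec, sub_add_cancel]
  | succ j ih =>
    rw [groverOrbit_succ, groverOrbit_succ j, ← Matrix.mulVec_add, ih, Matrix.mulVec_smul,
      ← groverOrbit_succ]

/-! ### The estimation procedure -/

/-- A unitary preparing the window in the work register. -/
def windowPrep (K : ℕ) : Matrix.unitaryGroup (Fin (K + 1)) ℂ :=
  ⟨_, (exists_unitary_column (fun j : Fin (K + 1) => windowAmp K (j + 1)) 0
    (sum_norm_sq_windowAmp K)).choose_spec.1⟩

theorem windowPrep_apply (K : ℕ) (j : Fin (K + 1)) :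
    (windowPrep K).1 j 0 = windowAmp K (j + 1) :=
  (exists_unitary_column (fun j : Fin (K + 1) => windowAmp K (j + 1)) 0
    (sum_norm_sq_windowAmp K)).choose_spec.2 j

/-- A unitary acting on the work register alone. -/
def onWork (n : ℕ) {K : ℕ} (U : Matrix.unitaryGroup (Fin (K + 1)) ℂ) :
    Matrix.unitaryGroup (Reg n × Fin (K + 1)) ℂ :=
  ⟨(1 : Matrix (Reg n) (Reg n) ℂ) ⊗ₖ U.1, Matrix.kronecker_mem_unitary (one_mem _) U.2⟩

/-- The blocks of the phase flip between the calls number `t` and `t + 1`. -/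
def flipBlock (n t j : ℕ) : Matrix (Reg n) (Reg n) ℂ :=
  if t / 2 + 1 ≤ j then (if Even t then ancillaFlip n else initFlip n) else 1

/-- The phase flip between the calls number `t` and `t + 1`, controlled by the work register. -/
def ctrlFlip (n K t : ℕ) : Matrix.unitaryGroup (Reg n × Fin (K + 1)) ℂ :=
  ⟨Matrix.blockDiagonal fun j : Fin (K + 1) => flipBlock n t j, by
    refine blockDiagonal_mem_unitaryGroup fun j => ?_
    unfold flipBlock
    split_ifs
    exacts [ancillaFlip_mem_unitaryGroup n, initFlip_mem_unitaryGroup n, one_mem _]⟩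

/-- Amplitude estimation with `M` calls: a superposition of Grover powers weighted by the window,
followed by a measurement of the half path in its eigenbasis. -/
def estimationAlgorithm (n M : ℕ) : QueryAlgorithm n where
  -- K = (M-1)/2 is the largest number of Grover steps with 2K + 1 ≤ M (for M ≥ 1).
  Work := Fin ((M - 1) / 2 + 1)
  start := 0
  calls := M
  step
    | 0 => onWork n (windowPrep _)
    | t + 1 => if t + 1 = M then onWork n (star (isHermitian_halfPath _).eigenvectorUnitary)
        else ctrlFlip n _ t
  -- Call 0 acts in every branch. Calls 2r - 1 and 2r form the Grover step number r, performed only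
  -- in the branches j ≥ r. If M is even and positive, the last call acts in no branch and only
  -- brings the count to M.
  control t j := decide ((t + 1) / 2 ≤ (j : ℕ))
  inverse t := decide (Odd t)
  estimate x := (1 - (isHermitian_halfPath _).eigenvalues x.2) / 2

/-- The blocks of the call number `t`. -/
def callBlock (A : Matrix (Reg n) (Reg n) ℂ) (t j : ℕ) : Matrix (Reg n) (Reg n) ℂ :=
  if (t + 1) / 2 ≤ j then (if Odd t then Aᴴ else A) else 1

/-- The state of the register after the call number `t`, in the block `j` of the work register. -/
def blockState (A : Matrix (Reg n) (Reg n) ℂ) (j : ℕ) : ℕ → Reg n → ℂ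
  | 0 => callBlock A 0 j *ᵥ initState n
  | t + 1 => callBlock A (t + 1) j *ᵥ (flipBlock n t j *ᵥ blockState A j t)

/-- Two calls and the two flips before them make one Grover step; branch j freezes after j steps,
hence the minimum. -/
theorem blockState_two_mul (hA : A ∈ Matrix.unitaryGroup (Reg n) ℂ) (j r : ℕ) :
    blockState A j (2 * r) = groverOrbit A (min r j + 1) := by
  induction r with
  | zero => simp [blockState, callBlock, groverOrbit_one hA]
  | succ r ih =>
    have h1 : (2 * r + 1) / 2 = r := by omega
    have h2 : (2 * r + 1 + 1) / 2 = r + 1 := by omega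
    have h3 : (2 * r + 1 + 1 + 1) / 2 = r + 1 := by omega
    have h4 : ¬ Odd (2 * r + 1 + 1) := by
      rw [Nat.not_odd_iff_even]
      exact ⟨r + 1, by ring⟩
    have h5 : ¬ Even (2 * r + 1) := by simp
    rw [show 2 * (r + 1) = 2 * r + 1 + 1 by ring, blockState, blockState, ih]
    simp only [callBlock, flipBlock, h1, h2, h3, h4, h5, Nat.mul_div_cancel_left r two_pos,
      even_two_mul, odd_two_mul_add_one, if_true, if_false]
    split_ifs with hj
    · rw [min_eq_left (by omega), min_eq_left hj, groverOrbit_succ (r + 1), groverStep]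
      simp only [Matrix.mulVec_mulVec, mul_assoc]
    · rw [min_eq_right (by omega), min_eq_right (by omega)]
      simp only [Matrix.one_mulVec]

theorem blockState_last (hA : A ∈ Matrix.unitaryGroup (Reg n) ℂ) {t j : ℕ} (hj : j ≤ t / 2) :
    blockState A j t = groverOrbit A (j + 1) := by
  rcases Nat.even_or_odd' t with ⟨r, rfl | rfl⟩
  · rw [blockState_two_mul hA, min_eq_right (by omega)]
  · rw [blockState, blockState_two_mul hA, min_eq_right (by omega), callBlock, flipBlock,
      if_neg (by omega), if_neg (by omega), Matrix.one_mulVec, Matrix.one_mulVec]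

theorem estimationAlgorithm_callMatrix (M t : ℕ) :
    (estimationAlgorithm n M).callMatrix A t
      = Matrix.blockDiagonal fun j : Fin ((M - 1) / 2 + 1) => callBlock A t j := by
  unfold QueryAlgorithm.callMatrix callBlock
  simp only [estimationAlgorithm, decide_eq_true_eq]
  rfl

/-- Calls and flips are block diagonal in the work register, so the branches evolve independently
and keep their window amplitudes as factors. -/
theorem estimationAlgorithm_call_state {M : ℕ} {t : ℕ} (ht : t < M)
    (x : Reg n × Fin ((M - 1) / 2 + 1)) :
    ((estimationAlgorithm n M).callMatrix A t *ᵥ (estimationAlgorithm n M).state A t) x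
      = windowAmp ((M - 1) / 2) (x.2 + 1) * blockState A x.2 t x.1 := by
  induction t generalizing x with
  | zero =>
    have h : ∀ y : Reg n × Fin ((M - 1) / 2 + 1), (estimationAlgorithm n M).state A 0 y
        = windowAmp ((M - 1) / 2) (y.2 + 1) * initState n y.1 := by
      intro y
      change (((1 : Matrix (Reg n) (Reg n) ℂ) ⊗ₖ (windowPrep _).1) *ᵥ
        Pi.single ((0, fun _ => false), 0) 1) y = _
      rw [Matrix.mulVec_single_one, Matrix.col_apply, Matrix.kroneckerMap_apply, windowPrep_apply,
        mul_comm, initState, Matrix.one_apply, Pi.single_apply]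
    rw [estimationAlgorithm_callMatrix]
    refine (blockDiagonal_mulVec_apply _ _ x).trans ?_
    rw [blockState, ← smul_eq_mul, ← Pi.smul_apply, ← Matrix.mulVec_smul]
    congr 2
    ext1 p
    exact h _
  | succ t ih =>
    have h : ∀ y : Reg n × Fin ((M - 1) / 2 + 1), (estimationAlgorithm n M).state A (t + 1) y
        = windowAmp ((M - 1) / 2) (y.2 + 1) * (flipBlock n t y.2 *ᵥ blockState A y.2 t) y.1 := by
      intro y
      have hs : (estimationAlgorithm n M).step (t + 1) = ctrlFlip n ((M - 1) / 2) t :=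
        if_neg ht.ne
      rw [QueryAlgorithm.state, hs]
      refine (blockDiagonal_mulVec_apply _ _ y).trans ?_
      rw [← smul_eq_mul, ← Pi.smul_apply, ← Matrix.mulVec_smul]
      congr 2
      ext1 p
      exact ih (by omega) _
    rw [estimationAlgorithm_callMatrix]
    refine (blockDiagonal_mulVec_apply _ _ x).trans ?_
    rw [blockState, ← smul_eq_mul, ← Pi.smul_apply, ← Matrix.mulVec_smul]
    congr 2
    ext1 p
    exact h _

theorem estimationAlgorithm_state (hA : A ∈ Matrix.unitaryGroup (Reg n) ℂ) {M : ℕ} (hM : 1 ≤ M)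
    (x : Reg n × Fin ((M - 1) / 2 + 1)) :
    (estimationAlgorithm n M).state A M x
      = ((star (isHermitian_halfPath ((M - 1) / 2)).eigenvectorUnitary).1 *ᵥ fun j =>
          windowAmp ((M - 1) / 2) (j + 1) * groverOrbit A (j + 1) x.1) x.2 := by
  obtain ⟨t, rfl⟩ : ∃ t, M = t + 1 := ⟨M - 1, by omega⟩
  have hs : (estimationAlgorithm n (t + 1)).step (t + 1)
      = onWork n (star (isHermitian_halfPath ((t + 1 - 1) / 2)).eigenvectorUnitary) :=
    if_pos rfl
  rw [QueryAlgorithm.state, hs]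
  refine (one_kronecker_mulVec_apply _ _ x).trans ?_
  congr 2
  ext1 j
  rw [estimationAlgorithm_call_state (Nat.lt_succ_self t), blockState_last hA]
  exact Nat.lt_succ_iff.1 j.2

theorem rmsError_estimationAlgorithm_le (hA : A ∈ Matrix.unitaryGroup (Reg n) ℂ) {M : ℕ}
    (hM : 1 ≤ M) :
    rmsError ((estimationAlgorithm n M).law A) (estimationAlgorithm n M).estimate (amplitude A)
      ≤ 6 / M := by
  have hM0 : (0 : ℝ) < M := by exact_mod_cast hM
  refine Real.sqrt_le_iff.2 ⟨by positivity, ?_⟩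
  set K := (M - 1) / 2 with hK
  set c : ℝ := 1 - 2 * amplitude A with hc
  -- An outcome λ has estimation error (c - λ)/2, whence the factor 1/4; the deviation identity is
  -- applied separately for each basis state p of the register.
  have hmse : ∑ x, (estimationAlgorithm n M).law A x *
      ((estimationAlgorithm n M).estimate x - amplitude A) ^ 2
        = 1 / 4 * ∑ p, ∑ j : Fin (K + 1),
          ‖(halfPath K *ᵥ fun i => windowAmp K (i + 1) * groverOrbit A (i + 1) p) j
            - c * (windowAmp K (j + 1) * groverOrbit A (j + 1) p)‖ ^ 2 := by
    rw [Finset.mul_sum]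
    refine (Fintype.sum_prod_type _).trans (Finset.sum_congr rfl fun p _ => ?_)
    rw [← sum_norm_sq_mul_eigenvalues_sub (isHermitian_halfPath K)
      (fun i => windowAmp K (i + 1) * groverOrbit A (i + 1) p), Finset.mul_sum]
    refine Finset.sum_congr rfl fun k _ => ?_
    have h1 : (estimationAlgorithm n M).law A (p, k)
        = ‖((star (isHermitian_halfPath K).eigenvectorUnitary).1 *ᵥ fun j : Fin (K + 1) =>
          windowAmp K (j + 1) * groverOrbit A (j + 1) p) k‖ ^ 2 :=
      congrArg (fun z : ℂ => ‖z‖ ^ 2) (estimationAlgorithm_state hA hM (p, k))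
    have h2 : (estimationAlgorithm n M).estimate (p, k)
        = (1 - (isHermitian_halfPath K).eigenvalues k) / 2 := rfl
    rw [h1, h2, hc]
    ring
  have hbound := sum_norm_sq_halfPath_sub_le (K := K) (c := c) (sum_norm_sq_groverOrbit hA)
    fun j p => congrFun (groverOrbit_add hA j) p
  have hMK : (M : ℝ) / 2 ≤ K + 1 := by
    have : M ≤ 2 * (K + 1) := by omega
    have : (M : ℝ) ≤ 2 * (K + 1) := by exact_mod_cast this
    linarith
  rw [hmse]
  calc _ ≤ 1 / 4 * (30 / ((K : ℝ) + 1) ^ 2) := by linarith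
    _ ≤ 1 / 4 * (30 / ((M : ℝ) / 2) ^ 2) := by gcongr
    _ = 30 / (M : ℝ) ^ 2 := by
      field_simp
      norm_num
    -- Rounding 30 up to a square gives the constant 6.
    _ ≤ 36 / (M : ℝ) ^ 2 := by gcongr; norm_num
    _ = (6 / M) ^ 2 := by
      rw [div_pow]
      norm_num

end

/-! ### Asymptotics of the resources -/

theorem chooseLE_le_pow (n d : ℕ) : chooseLE n d ≤ (n + 1) ^ d := by
  induction d with
  | zero => simp [chooseLE]
  | succ d ih =>
    have h : chooseLE n (d + 1) = chooseLE n d + n.choose (d + 1) :=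
      Finset.sum_range_succ _ _
    rw [h]
    calc _ ≤ (n + 1) ^ d + n ^ (d + 1) := add_le_add ih (Nat.choose_le_pow n _)
      _ ≤ (n + 1) ^ d + n * (n + 1) ^ d := by
        rw [pow_succ']
        gcongr
        omega
      _ = (n + 1) ^ (d + 1) := by ring

theorem natCeil_le_abs_add_one (x : ℝ) : (⌈x⌉₊ : ℝ) ≤ |x| + 1 := by
  calc (⌈x⌉₊ : ℝ) ≤ ⌈|x|⌉₊ := by exact_mod_cast Nat.ceil_mono (le_abs_self x)
    _ ≤ |x| + 1 := (Nat.ceil_lt_add_one (abs_nonneg x)).le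

theorem abs_logb_div_le {B ε : ℝ} (hε : 0 < ε) (hL : 0 ≤ Real.log (1 / ε)) :
    |Real.logb 2 (B / ε)| ≤ (|Real.log B| + Real.log (1 / ε)) / Real.log 2 := by
  have h2 : 0 < Real.log 2 := Real.log_pos one_lt_two
  rw [Real.logb, abs_div, abs_of_pos h2]
  gcongr
  rcases eq_or_ne B 0 with rfl | hB
  · simpa using hL
  · rw [div_eq_mul_one_div, Real.log_mul hB (by positivity)]
    exact (abs_add_le _ _).trans_eq (by rw [abs_of_nonneg hL])

/-- The summand 1 matches the base in `chooseLE_le_pow`. -/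
theorem isBigO_natCeil_qubitBound {p : ℕ} (hp : 1 ≤ p) (Cp : ℝ) (g : ℝ → ℝ) :
    (fun ε : ℝ => (⌈qubitBound p Cp g ε⌉₊ : ℝ) + 1)
      =O[𝓝[>] 0] fun ε : ℝ => Real.log (1 / ε) / p := by
  have hp0 : (0 : ℝ) < p := by exact_mod_cast hp
  have h2 : 0 < Real.log 2 := Real.log_pos one_lt_two
  set B := 2 * Cp * supNormDeriv p g with hB
  -- For ε < 1/e the logarithm L is at least 1 and absorbs the constants: |log B| + L ≤ (|log B| +
  -- 1)L, and the 2 from rounding up and the extra 1 is at most 2L = 2p · (L/p).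
  refine Asymptotics.IsBigO.of_bound ((|Real.log B| + 1) / Real.log 2 + 2 * p) ?_
  filter_upwards [Ioo_mem_nhdsGT (Real.exp_pos (-1))] with ε hε
  have hL : 1 ≤ Real.log (1 / ε) := by
    rw [one_div, Real.log_inv, le_neg]
    exact (Real.log_le_iff_le_exp hε.1).2 hε.2.le
  set L := Real.log (1 / ε)
  have hq : |qubitBound p Cp g ε| ≤ 1 / p * ((|Real.log B| + L) / Real.log 2) := by
    rw [qubitBound, ← hB, abs_mul, abs_of_pos (one_div_pos.2 hp0)]
    gcongr
    exact abs_logb_div_le hε.1 (by linarith)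
  have hBL : |Real.log B| + L ≤ (|Real.log B| + 1) * L := by
    nlinarith [mul_le_mul_of_nonneg_left hL (abs_nonneg (Real.log B))]
  rw [Real.norm_of_nonneg (by positivity), Real.norm_of_nonneg (by positivity)]
  calc (⌈qubitBound p Cp g ε⌉₊ : ℝ) + 1 ≤ |qubitBound p Cp g ε| + 2 := by
        linarith [natCeil_le_abs_add_one (qubitBound p Cp g ε)]
    _ ≤ 1 / p * (((|Real.log B| + 1) * L) / Real.log 2) + 2 * L := by
        have : 1 / (p : ℝ) * ((|Real.log B| + L) / Real.log 2)
            ≤ 1 / p * (((|Real.log B| + 1) * L) / Real.log 2) := by gcongr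
        linarith
    _ = ((|Real.log B| + 1) / Real.log 2 + 2 * p) * (L / p) := by field_simp

theorem isBigO_natCeil_callBound {C δ : ℝ} (hC : 0 < C) :
    (fun ε : ℝ => (⌈callBound C δ ε⌉₊ : ℝ)) =O[𝓝[>] 0] fun ε : ℝ => 1 / ε := by
  refine Asymptotics.IsBigO.of_bound (2 * C / √δ + 1) ?_
  filter_upwards [Ioo_mem_nhdsGT one_pos] with ε hε
  have h0 := hε.1
  have h1 : 1 ≤ 1 / ε := (one_le_div h0).2 hε.2.le
  have hc : callBound C δ ε = 2 * C / √δ * (1 / ε) := by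
    rw [callBound, div_mul_div_comm, mul_one, mul_comm ε]
  rw [Real.norm_of_nonneg (by positivity), Real.norm_of_nonneg (by positivity)]
  calc (⌈callBound C δ ε⌉₊ : ℝ) ≤ |callBound C δ ε| + 1 := natCeil_le_abs_add_one _
    _ = 2 * C / √δ * (1 / ε) + 1 := by rw [hc, abs_of_nonneg (by positivity)]
    _ ≤ (2 * C / √δ + 1) * (1 / ε) := by linarith

theorem isBigO_totalGates {p : ℕ} (hp : 1 ≤ p) (d : ℕ) (Cp : ℝ) (g : ℝ → ℝ) {C δ : ℝ}
    (hC : 0 < C) :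
    (fun ε : ℝ => (chooseLE ⌈qubitBound p Cp g ε⌉₊ d : ℝ) * (⌈callBound C δ ε⌉₊ : ℝ))
      =O[𝓝[>] 0] fun ε : ℝ => (Real.log (1 / ε) / p) ^ d * (1 / ε) := by
  refine Asymptotics.IsBigO.mul ?_ (isBigO_natCeil_callBound hC)
  refine Asymptotics.IsBigO.trans ?_ ((isBigO_natCeil_qubitBound hp Cp g).pow d)
  refine Asymptotics.IsBigO.of_norm_le fun ε => ?_
  rw [Real.norm_of_nonneg (Nat.cast_nonneg _)]
  exact_mod_cast chooseLE_le_pow _ d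

end QAE

end

theorem mainTheorem3 :
    ∃ C₀ : ℝ, 0 < C₀ ∧ ∃ alg : (n M : ℕ) → QAE.QueryAlgorithm n,
      -- an amplitude estimation procedure with `M` oracle calls and error `C₀ / M`
      (∀ n M : ℕ, (alg n M).calls = M) ∧
      (∀ n M : ℕ, 1 ≤ M → ∀ A ∈ Matrix.unitaryGroup (QAE.Reg n) ℂ,
        QAE.rmsError ((alg n M).law A) (alg n M).estimate (QAE.amplitude A) ≤ C₀ / M) ∧
      ∀ (g : ℝ → ℝ) (p d : ℕ) (α : ℕ∞) (Cp δ : ℝ),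
        (∀ x ∈ Set.Icc (0 : ℝ) 1, g x ∈ Set.Icc (0 : ℝ) 1) →
        1 ≤ p → (p : ℕ∞) ≤ α → ContDiffOn ℝ α g (Set.Icc 0 1) →
        0 < Cp → 0 < δ → δ < 1 →
        (∀ (n : ℕ) (R : QAE.QuadratureRule n) (V : Matrix (QAE.Bits n) (QAE.Bits n) ℂ),
          R.Prepares V →
          R.samples g ∈ QAE.angleClass n d →
          R.error g ≤ Cp * ((2 : ℝ) ^ (p * n))⁻¹ * QAE.supNormDeriv p g →
          -- one oracle call costs `∑_{k ≤ d} n.choose k` gates and encodes `Q_n[g]`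
          (QAE.circuitMatrix (QAE.monomialCircuit d (R.samples g)) =
              QAE.encodingOp (R.samples g) ∧
            (QAE.monomialCircuit d (R.samples g)).length = QAE.chooseLE n d ∧
            QAE.amplitude (QAE.amplitudeOracle (R.samples g) V) = R.approx g) ∧
          ∀ ε : ℝ, 0 < ε → QAE.qubitBound p Cp g ε ≤ n →
            -- maximum likelihood estimation, `Cest` being any constant in its error bound
            (∀ (Cest : ℝ) (S : QAE.Schedule) (est : S.Record → ℝ), 0 < Cest → S.IsMLAE est →
              QAE.rmsError (S.law (QAE.amplitudeOracle (R.samples g) V)) est (R.approx g)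
                ≤ Cest / S.cost →
              QAE.callBound Cest δ ε ≤ S.cost →
              1 - δ ≤ QAE.finProb (S.law (QAE.amplitudeOracle (R.samples g) V))
                {ω | |(∫ x in (0 : ℝ)..1, g x) - est ω| ≤ ε}) ∧
            -- the procedure `alg`
            (∀ M : ℕ, QAE.callBound C₀ δ ε ≤ M →
              1 - δ ≤ QAE.finProb ((alg n M).law (QAE.amplitudeOracle (R.samples g) V))
                {x | |(∫ x in (0 : ℝ)..1, g x) - (alg n M).estimate x| ≤ ε})) ∧
        -- total gate count for the minimal numbers of qubits and of oracle calls
        (∀ Cest : ℝ, 0 < Cest →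
          (fun ε : ℝ => (QAE.chooseLE ⌈QAE.qubitBound p Cp g ε⌉₊ d : ℝ) *
              (⌈QAE.callBound Cest δ ε⌉₊ : ℝ))
            =O[𝓝[>] 0] fun ε : ℝ => (Real.log (1 / ε) / p) ^ d * (1 / ε)) := by
  refine ⟨6, by norm_num, QAE.estimationAlgorithm, fun _ _ => rfl,
    fun n M hM A hA => QAE.rmsError_estimationAlgorithm_le hA hM, ?_⟩
  intro g p d α Cp δ hg hp _ _ hCp hδ _
  refine ⟨fun n R V hV hclass herr => ?_, fun Cest hC => QAE.isBigO_totalGates hp d Cp g hC⟩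
  have hA := QAE.amplitudeOracle_mem_unitaryGroup (R.samples g) hV.1
  have hamp : QAE.amplitude (QAE.amplitudeOracle (R.samples g) V) = R.approx g :=
    QAE.amplitude_amplitudeOracle R (fun b => hg _ (R.node_mem b)) hV
  refine ⟨⟨QAE.circuitMatrix_monomialCircuit hclass, QAE.length_monomialCircuit d _, hamp⟩,
    fun ε hε hn => ?_⟩
  have hq : |(∫ x in (0 : ℝ)..1, g x) - R.approx g| ≤ ε / 2 :=
    herr.trans (QAE.discretisation_error_le hp hCp hε (QAE.supNormDeriv_nonneg p g) hn)
  refine ⟨fun Cest S est hC _ hrms hM => ?_, fun M hM => ?_⟩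
  · exact QAE.one_sub_le_finProb (S.law_nonneg hA) (S.sum_law _) hε hδ hq
      (QAE.rms_le_of_callBound_le hC hδ hε hrms hM)
  -- The error bound of the algorithm needs M ≥ 1, which the positive call bound forces.
  · have hM0 : (0 : ℝ) < M := by
      refine lt_of_lt_of_le ?_ hM
      have := Real.sqrt_pos.2 hδ
      unfold QAE.callBound
      positivity
    have hrms := QAE.rmsError_estimationAlgorithm_le hA (M := M) (by exact_mod_cast hM0)
    rw [hamp] at hrms
    exact QAE.one_sub_le_finProb (QAE.QueryAlgorithm.law_nonneg _)
      (QAE.QueryAlgorithm.sum_law _ hA) hε hδ hq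
      (QAE.rms_le_of_callBound_le (by norm_num) hδ hε hrms hM)
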